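/- **Definitions.** A *triangulation* $T$ (of a square) is a finite oriented simplicial complex homeomorphic to a closed disk, with exactly four vertices on its boundary, labelled $\mathbf p,\mathbf q,\mathbf r,\mathbf s$ in the cyclic order given by the orientation. A *drawing* of $T$ is a map $\rho$ from the vertices of $T$ to $\mathbf C^2$ with $\rho(\mathbf p)+\rho(\mathbf r)=\rho(\mathbf q)+\rho(\mathbf s)$. Each triangle $\Delta$ of $T$, with vertices $v_1,v_2,v_3$ in an order compatible with the orientation and $\rho(v_i)=(x_i,y_i)$, has the area $$\tfrac12\det\begin{pmatrix}1&1&1\\x_1&x_2&x_3\\y_1&y_2&y_3\end{pmatrix}.$$ An *area polynomial* $p_T$ of $T$ is a homogeneous integer polynomial, in one variable $A_\Delta$ for each triangle $\Delta$ of $T$, whose coefficients have no common factor and which generates the ideal of all complex polynomials that vanish on the area tuples of all drawings of $T$; it is unique up to sign. For a set $L$ of $l$ variables, the *$l$-variable specialization* $p_T|_L$ is obtained from $p_T$ by substituting $0$ for all variables not in $L$. Let $K$ be a field of characteristic $0$ (for example $K=\mathbf Q$). Two polynomials in $l$ variables over $K$ are *equivalent* if they agree up to a nonzero scalar in $K$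 and a permutation of the variables. For $l\ge 1$ let $\mathcal E_l$ be the set of equivalence classes of irreducible factors over $K$ of $l$-variable specializations of area polynomials $p_T$, where $T$ ranges over all triangulations, and let $\mathcal E=\bigcup_{l\ge1}\mathcal E_l$ (the *area encyclopedia*). A polynomial is said to be in $\mathcal E$ if its equivalence class is. An *algebraic subdivision* of a polynomial $q$ in $n$ variables is a polynomial in $n+1$ variables obtained from $q$ by substituting $X'+X''$ for one of the $n$ variables $X$, where $X',X''$ are new variables. The *abridged encyclopedia* is $\tilde{\mathcal E}=\bigcup_{l\ge 1}\tilde{\mathcal E}_l$, where $\tilde{\mathcal E}_l$ consists of the polynomials in $\mathcal E_l$ that are not, up to equivalence, an algebraic subdivision of any polynomial in $\mathcal E_{l-1}$ (with $\mathcal E_0=\emptyset$). **Proposition.** 1. If $q^\star$ is an algebraic subdivision of $q$, then $q^\star\in\mathcal E$ if and only if $q\in\mathcal E$. 2. $\mathcal E$ is the closure of $\tilde{\mathcal E}$ under algebraic subdivision: a polynomial $q$ is in $\mathcal E$ if and only if $q$ can be obtained from some polynomial in $\tilde{\mathcal E}$ by a finite (possibly empty) sequence of algebraic subdivisions. -/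

import Mathlib

noncomputable section

namespace AreaEncyclopedia

open MvPolynomial

/-! ### Triangulations of a square -/

/-- A finite, pure two-dimensional simplicial complex with vertex set `V`, whose triangles are
indexed by `ι`.  The triple `tri i` lists the three vertices of the `i`-th triangle in an order
that represents the orientation of that triangle. -/
structure OrientedTriangles where
  V : Type
  ι : Type
  [fintypeV : Fintype V]
  [fintypeι : Fintype ι]
  tri : ι → Fin 3 → V
  tri_injective : ∀ i, Function.Injective (tri i)
  /-- a set of three vertices spans at most one triangle -/
  eq_of_range_eq : ∀ i j, Set.range (tri i) = Set.range (tri j) → i = j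
  /-- every vertex is a vertex of some triangle -/
  exists_mem_range : ∀ v, ∃ i, v ∈ Set.range (tri i)

attribute [instance] OrientedTriangles.fintypeV OrientedTriangles.fintypeι

/-- The underlying abstract simplicial complex: its faces are the nonempty subsets of the vertex
sets of the triangles. -/
def OrientedTriangles.complex (T : OrientedTriangles) : AbstractSimplicialComplex T.V where
  faces := {s | s.Nonempty ∧ ∃ i, (s : Set T.V) ⊆ Set.range (T.tri i)}
  isRelLowerSet_faces := by
    rintro s ⟨hs, i, hi⟩
    exact ⟨hs, fun t hts ht => ⟨ht, i, fun v hv => hi (hts hv)⟩⟩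
  singleton_mem := fun v => by
    obtain ⟨i, hi⟩ := T.exists_mem_range v
    exact ⟨Finset.singleton_nonempty v, i, by simpa using hi⟩

/-- The geometric realization of a finite abstract simplicial complex, in barycentric
coordinates. -/
def realization {V : Type*} [Fintype V] (K : AbstractSimplicialComplex V) : Set (V → ℝ) :=
  {x | (∀ v, 0 ≤ x v) ∧ ∑ v, x v = 1 ∧ ∃ s ∈ K.faces, (s : Set V) = Function.support x}

/-- The directed edge `(u, v)` belongs to the boundary of the oriented triangle `i`
(indices in `Fin 3` are cyclic). -/
def OrientedTriangles.HasDirectedEdge (T : OrientedTriangles) (i : T.ι) (u v : T.V) : Prop :=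
  ∃ k : Fin 3, T.tri i k = u ∧ T.tri i (k + 1) = v

/-- A triangulation of a square: an oriented simplicial complex homeomorphic to a disk, with
exactly four vertices on the boundary, labelled in the cyclic order given by the orientation. -/
structure Triangulation extends OrientedTriangles where
  homeomorphic_disk : Nonempty (realization toOrientedTriangles.complex ≃ₜ
    Metric.closedBall (0 : EuclideanSpace ℝ (Fin 2)) 1)
  /-- The orientation is coherent: triangles that share an edge induce opposite directions on
  it. -/
  coherent : ∀ i j u v, toOrientedTriangles.HasDirectedEdge i u v →
    toOrientedTriangles.HasDirectedEdge j u v → i = j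
  /-- the corners `𝐩, 𝐪, 𝐫, 𝐬` -/
  corner : Fin 4 → V
  corner_injective : Function.Injective corner
  /-- The boundary (the edges that lie in only one triangle, with the induced direction) is the
  cycle `𝐩 → 𝐪 → 𝐫 → 𝐬 → 𝐩`. -/
  boundary_iff : ∀ u v,
    ((∃ i, toOrientedTriangles.HasDirectedEdge i u v) ∧
      ¬ ∃ i, toOrientedTriangles.HasDirectedEdge i v u) ↔
    ∃ k : Fin 4, corner k = u ∧ corner (k + 1) = v

/-! ### Drawings, areas and the area polynomial -/

/-- The space of drawings: maps from the vertices to `ℂ²` that send the corners to the vertices of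
a possibly degenerate parallelogram. -/
def drawings (T : Triangulation) : Set (T.V → Fin 2 → ℂ) :=
  {ρ | ρ (T.corner 0) + ρ (T.corner 2) = ρ (T.corner 1) + ρ (T.corner 3)}

/-- The area of an ordered triangle in `ℂ²`. -/
def area (a b c : Fin 2 → ℂ) : ℂ :=
  (1 / 2) * Matrix.det !![1, 1, 1; a 0, b 0, c 0; a 1, b 1, c 1]

/-- The tuple of areas of the triangles in a drawing. -/
def areaTuple (T : Triangulation) (ρ : T.V → Fin 2 → ℂ) : T.ι → ℂ :=
  fun i => area (ρ (T.tri i 0)) (ρ (T.tri i 1)) (ρ (T.tri i 2))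

/-- `p` is an area polynomial of `T`: a homogeneous integer polynomial whose coefficients have no
common factor and which defines the area variety, i.e. it generates over `ℂ` the ideal of all
polynomials that vanish on the area tuples of all drawings.  (The set of area tuples is stable
under scaling, so this is the homogeneous ideal of the closure of its image in projective
space.) -/
def IsAreaPolynomial (T : Triangulation) (p : MvPolynomial T.ι ℤ) : Prop :=
  (∃ d, p.IsHomogeneous d) ∧
  (∀ c : ℤ, C c ∣ p → IsUnit c) ∧
  vanishingIdeal ℂ (areaTuple T '' drawings T) = Ideal.span {map (Int.castRingHom ℂ) p}

/-! ### The area encyclopedia -/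

open Classical in
/-- The specialization `p|_L`: substitute `0` for all variables that are not in `L`. -/
def specialize {σ R : Type*} [CommRing R] (L : Finset σ) (p : MvPolynomial σ R) :
    MvPolynomial L R :=
  aeval (fun i => if h : i ∈ L then X ⟨i, h⟩ else 0) p

/-- Equality of polynomials in `l` variables up to a nonzero scalar and a permutation of the
variables. -/
def PolyEquiv {K : Type*} [Field K] {l : ℕ} (q q' : MvPolynomial (Fin l) K) : Prop :=
  ∃ c : K, c ≠ 0 ∧ ∃ π : Equiv.Perm (Fin l), q' = C c * rename π q

/-- `q` is an irreducible factor of an `l`-variable specialization of an area polynomial.  The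
variables of the specialization, which are the elements of `L`, are numbered by `e`. -/
def IsAreaFactor {K : Type*} [Field K] {l : ℕ} (q : MvPolynomial (Fin l) K) : Prop :=
  ∃ (T : Triangulation) (p : MvPolynomial T.ι ℤ) (L : Finset T.ι) (e : L ≃ Fin l),
    IsAreaPolynomial T p ∧ Irreducible q ∧
      q ∣ rename e (specialize L (map (Int.castRingHom K) p))

/-- The `l`-th volume `ℰ_l` of the area encyclopedia over `K`, for positive `l`, given as the set
of all polynomials whose equivalence class belongs to it. -/
def encyclopedia (K : Type*) [Field K] (l : ℕ) : Set (MvPolynomial (Fin l) K) :=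
  {q | 0 < l ∧ ∃ q', PolyEquiv q' q ∧ IsAreaFactor q'}

/-- `q'` is obtained from `q` by substituting `X' + X''` for the variable `X i`.  The variables of
`q'` are numbered by `e`: the variable `X j` with `j ≠ i` becomes `X (e (some j))`, and `X'`, `X''`
are `X (e (some i))` and `X (e none)`. -/
def IsAlgSubdivision {K : Type*} [Field K] {n : ℕ}
    (q : MvPolynomial (Fin n) K) (q' : MvPolynomial (Fin (n + 1)) K) : Prop :=
  ∃ (i : Fin n) (e : Option (Fin n) ≃ Fin (n + 1)),
    q' = aeval (fun j => if j = i then X (e (some i)) + X (e none) else X (e (some j))) q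

/-- The same relation between polynomials in any numbers of variables. -/
inductive SubdivisionStep {K : Type*} [Field K] :
    (Σ n : ℕ, MvPolynomial (Fin n) K) → (Σ n : ℕ, MvPolynomial (Fin n) K) → Prop
  | mk {n : ℕ} (q : MvPolynomial (Fin n) K) (q' : MvPolynomial (Fin (n + 1)) K)
      (h : IsAlgSubdivision q q') : SubdivisionStep ⟨n, q⟩ ⟨n + 1, q'⟩

/-- The `l`-th volume of the abridged encyclopedia: the members of `ℰ_l` that are not, up to
equivalence, an algebraic subdivision of a member of `ℰ_{l-1}`. -/
def abridged (K : Type*) [Field K] (l : ℕ) : Set (MvPolynomial (Fin l) K) :=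
  {q | q ∈ encyclopedia K l ∧
    ¬ ∃ r ∈ encyclopedia K (l - 1), ∃ q', PolyEquiv q' q ∧ SubdivisionStep ⟨l - 1, r⟩ ⟨l, q'⟩}

end AreaEncyclopedia

end

noncomputable section

namespace AreaEncyclopedia

open MvPolynomial

/-! Everything rests on part 1. Substituting `X' + X''` for `X` is, up to a linear change of
variables, adjoining an unused variable, so it preserves and reflects irreducibility
(`irreducible_algSubdivide_iff`). If the subdivided polynomial divides a specialization of `p_T`,
setting `X'' = 0` shows that `q` divides a smaller specialization of the same `p_T`.

For the converse, place a new vertex inside the triangle Δ that carries `X`. The area polynomial of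
the new triangulation is `p_T` with `A_Δ` replaced by the sum of the three new areas
(`IsAreaPolynomial.subdivide`); setting one of these to zero leaves `X' + X''`. That this polynomial
vanishes on drawings is additivity of area. That it generates the ideal holds because, when Δ is
nondegenerate, two of the new areas can be prescribed freely: a relation `f`, expanded in these two,
has coefficients that are relations among the old areas, first where `A_Δ ≠ 0` and then everywhere
by restricting to lines of drawings. Hence `p_T` divides every coefficient.

Part 2 follows by descent on the number of variables. -/

/-! ### Central subdivision of a triangle -/

/-- The complex obtained from `T` by subdividing the triangle `i₀` with a new vertex `none` in its
interior. -/
def OrientedTriangles.centralSubdivision (T : OrientedTriangles) (i₀ : T.ι) :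
    OrientedTriangles where
  V := Option T.V
  ι := {j // j ≠ i₀} ⊕ Fin 3
  fintypeι := by classical infer_instance
  tri := Sum.elim (fun j k => some (T.tri j k))
    (fun k => ![some (T.tri i₀ k), some (T.tri i₀ (k + 1)), none])
  tri_injective := by
    rintro (j | k)
    · exact (Option.some_injective _).comp (T.tri_injective j)
    · have h : T.tri i₀ k ≠ T.tri i₀ (k + 1) := (T.tri_injective i₀).ne (by simp)
      intro a b
      fin_cases a <;> fin_cases b <;> simp [h, h.symm]
  eq_of_range_eq := by
    have hne : ∀ (j : {j // j ≠ i₀}) (k : Fin 3),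
        Set.range (fun l => some (T.tri j l)) ≠
          Set.range ![some (T.tri i₀ k), some (T.tri i₀ (k + 1)), none] := by
      intro j k h
      have : none ∈ Set.range (fun l => some (T.tri j l)) := h ▸ ⟨2, rfl⟩
      simp at this
    rintro (j | k) (j' | k') h
    · congr 1
      apply Subtype.ext
      apply T.eq_of_range_eq
      apply (Option.some_injective T.V).image_injective
      rw [← Set.range_comp, ← Set.range_comp]
      exact h
    · exact absurd h (hne _ _)
    · exact absurd h.symm (hne _ _)
    · have h0 : some (T.tri i₀ k) ∈ Set.range
          ![some (T.tri i₀ k'), some (T.tri i₀ (k' + 1)), none] := h ▸ ⟨0, rfl⟩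
      have h1 : some (T.tri i₀ (k + 1)) ∈ Set.range
          ![some (T.tri i₀ k'), some (T.tri i₀ (k' + 1)), none] := h ▸ ⟨1, rfl⟩
      simp only [Set.mem_range, Fin.exists_fin_succ, Matrix.cons_val_zero, Matrix.cons_val_succ,
        Option.some.injEq, (T.tri_injective i₀).eq_iff, reduceCtorEq, IsEmpty.exists_iff,
        or_false] at h0 h1
      congr 1
      clear h
      revert k k'
      decide
  exists_mem_range := by
    rintro (_ | v)
    · exact ⟨Sum.inr 0, 2, rfl⟩
    · obtain ⟨j, k, rfl⟩ := T.exists_mem_range v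
      by_cases hj : j = i₀
      · subst hj
        exact ⟨Sum.inr k, 0, rfl⟩
      · exact ⟨Sum.inl ⟨j, hj⟩, k, rfl⟩

/-! ### Directed edges, coherence and boundary of a central subdivision -/

section DirectedEdges

variable {T : OrientedTriangles} {i₀ : T.ι}

lemma hasDirectedEdge_centralSubdivision_inl {j : {j // j ≠ i₀}} {u v : Option T.V} :
    (T.centralSubdivision i₀).HasDirectedEdge (Sum.inl j) u v ↔
      ∃ u' v', u = some u' ∧ v = some v' ∧ T.HasDirectedEdge j u' v' := by
  constructor
  · rintro ⟨k, rfl, rfl⟩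
    exact ⟨_, _, rfl, rfl, k, rfl, rfl⟩
  · rintro ⟨_, _, rfl, rfl, k, rfl, rfl⟩
    exact ⟨k, rfl, rfl⟩

lemma hasDirectedEdge_centralSubdivision_inr {k : Fin 3} {u v : Option T.V} :
    (T.centralSubdivision i₀).HasDirectedEdge (Sum.inr k) u v ↔
      (u = some (T.tri i₀ k) ∧ v = some (T.tri i₀ (k + 1))) ∨
      (u = some (T.tri i₀ (k + 1)) ∧ v = none) ∨ (u = none ∧ v = some (T.tri i₀ k)) := by
  constructor
  · rintro ⟨l, rfl, rfl⟩
    fin_cases l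
    · exact Or.inl ⟨rfl, rfl⟩
    · exact Or.inr (Or.inl ⟨rfl, rfl⟩)
    · exact Or.inr (Or.inr ⟨rfl, rfl⟩)
  · rintro (⟨rfl, rfl⟩ | ⟨rfl, rfl⟩ | ⟨rfl, rfl⟩)
    · exact ⟨0, rfl, rfl⟩
    · exact ⟨1, rfl, rfl⟩
    · exact ⟨2, rfl, rfl⟩

lemma exists_hasDirectedEdge_centralSubdivision_some_some {u v : T.V} :
    (∃ i, (T.centralSubdivision i₀).HasDirectedEdge i (some u) (some v)) ↔
      ∃ i, T.HasDirectedEdge i u v := by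
  constructor
  · rintro ⟨j | k, h⟩
    · obtain ⟨u', v', hu, hv, h⟩ := hasDirectedEdge_centralSubdivision_inl.1 h
      cases hu
      cases hv
      exact ⟨_, h⟩
    · rcases hasDirectedEdge_centralSubdivision_inr.1 h with ⟨hu, hv⟩ | ⟨_, hv⟩ | ⟨hu, _⟩
      · cases hu
        cases hv
        exact ⟨i₀, k, rfl, rfl⟩
      · cases hv
      · cases hu
  · rintro ⟨j, h⟩
    by_cases hj : j = i₀
    · subst hj
      obtain ⟨k, rfl, rfl⟩ := h
      exact ⟨Sum.inr k, hasDirectedEdge_centralSubdivision_inr.2 (Or.inl ⟨rfl, rfl⟩)⟩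
    · exact ⟨Sum.inl ⟨j, hj⟩, hasDirectedEdge_centralSubdivision_inl.2 ⟨u, v, rfl, rfl, h⟩⟩

lemma exists_hasDirectedEdge_centralSubdivision_none_left {v : Option T.V} :
    (∃ i, (T.centralSubdivision i₀).HasDirectedEdge i none v) ↔
      ∃ k, v = some (T.tri i₀ k) := by
  constructor
  · rintro ⟨j | k, h⟩
    · obtain ⟨u', v', hu, _⟩ := hasDirectedEdge_centralSubdivision_inl.1 h
      cases hu
    · rcases hasDirectedEdge_centralSubdivision_inr.1 h with ⟨hu, _⟩ | ⟨hu, _⟩ | ⟨_, hv⟩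
      · cases hu
      · cases hu
      · exact ⟨k, hv⟩
  · rintro ⟨k, rfl⟩
    exact ⟨Sum.inr k, hasDirectedEdge_centralSubdivision_inr.2 (Or.inr (Or.inr ⟨rfl, rfl⟩))⟩

lemma exists_hasDirectedEdge_centralSubdivision_none_right {u : Option T.V} :
    (∃ i, (T.centralSubdivision i₀).HasDirectedEdge i u none) ↔
      ∃ k, u = some (T.tri i₀ k) := by
  constructor
  · rintro ⟨j | k, h⟩
    · obtain ⟨u', v', _, hv, _⟩ := hasDirectedEdge_centralSubdivision_inl.1 h
      cases hv
    · rcases hasDirectedEdge_centralSubdivision_inr.1 h with ⟨_, hv⟩ | ⟨hu, _⟩ | ⟨_, hv⟩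
      · cases hv
      · exact ⟨k + 1, hu⟩
      · cases hv
  · rintro ⟨k, rfl⟩
    refine ⟨Sum.inr (k - 1), hasDirectedEdge_centralSubdivision_inr.2 (Or.inr (Or.inl ⟨?_, rfl⟩))⟩
    rw [sub_add_cancel]

lemma centralSubdivision_coherent
    (hT : ∀ i j u v, T.HasDirectedEdge i u v → T.HasDirectedEdge j u v → i = j)
    (i j : (T.centralSubdivision i₀).ι) (u v : Option T.V)
    (hi : (T.centralSubdivision i₀).HasDirectedEdge i u v)
    (hj : (T.centralSubdivision i₀).HasDirectedEdge j u v) : i = j := by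
  -- The only edge of a new triangle that avoids the new vertex is an edge of `i₀` with the same
  -- direction, which by coherence of `T` no other old triangle has.
  have mixed : ∀ (j : {j // j ≠ i₀}) (k : Fin 3),
      (T.centralSubdivision i₀).HasDirectedEdge (Sum.inl j) u v →
      ¬ (T.centralSubdivision i₀).HasDirectedEdge (Sum.inr k) u v := by
    intro j k hj hk
    obtain ⟨u', v', rfl, rfl, h⟩ := hasDirectedEdge_centralSubdivision_inl.1 hj
    rcases hasDirectedEdge_centralSubdivision_inr.1 hk with ⟨hu, hv⟩ | ⟨_, hv⟩ | ⟨hu, _⟩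
    · cases hu
      cases hv
      exact j.2 (hT _ _ _ _ h ⟨k, rfl, rfl⟩)
    · cases hv
    · cases hu
  rcases i with i | k <;> rcases j with j | k'
  · obtain ⟨u', v', rfl, rfl, h⟩ := hasDirectedEdge_centralSubdivision_inl.1 hi
    obtain ⟨_, _, hu, hv, h'⟩ := hasDirectedEdge_centralSubdivision_inl.1 hj
    cases hu
    cases hv
    exact congrArg Sum.inl (Subtype.ext (hT _ _ _ _ h h'))
  · exact absurd hj (mixed _ _ hi)
  · exact absurd hi (mixed _ _ hj)
  · rw [hasDirectedEdge_centralSubdivision_inr] at hi hj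
    congr 1
    rcases hi with ⟨rfl, rfl⟩ | ⟨rfl, rfl⟩ | ⟨rfl, rfl⟩ <;>
      simpa [(T.tri_injective i₀).eq_iff] using hj

end DirectedEdges

/-! ### The realization of a central subdivision -/

lemma mem_realization_complex_iff {T : OrientedTriangles} {x : T.V → ℝ} :
    x ∈ realization T.complex ↔
      (∀ v, 0 ≤ x v) ∧ ∑ v, x v = 1 ∧ ∃ i, ∀ v, x v ≠ 0 → v ∈ Set.range (T.tri i) := by
  classical
  constructor
  · rintro ⟨h0, h1, s, ⟨_, i, hi⟩, hs⟩
    exact ⟨h0, h1, i, fun v hv => hi (hs ▸ hv)⟩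
  · rintro ⟨h0, h1, i, hi⟩
    refine ⟨h0, h1, Finset.univ.filter (fun v => x v ≠ 0), ⟨?_, i, ?_⟩, ?_⟩
    · by_contra hne
      rw [Finset.not_nonempty_iff_eq_empty, Finset.filter_eq_empty_iff] at hne
      simp only [Finset.mem_univ, not_not, forall_const] at hne
      simp [hne] at h1
    · intro v hv
      exact hi v (by simpa using hv)
    · ext v
      simp

section Realization

variable (T : OrientedTriangles) (i₀ : T.ι)

/-- The smallest of the coordinates at the three vertices of the triangle `i₀`. -/
def minCoord (y : T.V → ℝ) : ℝ :=
  min (y (T.tri i₀ 0)) (min (y (T.tri i₀ 1)) (y (T.tri i₀ 2)))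

open Classical in
/-- The piecewise linear map of barycentric coordinates that sends the new vertex to the barycenter
of the triangle `i₀`. -/
def mergeCoords (x : Option T.V → ℝ) : T.V → ℝ :=
  fun v => x (some v) + if v ∈ Set.range (T.tri i₀) then x none / 3 else 0

open Classical in
/-- The inverse of `mergeCoords`. -/
def splitCoords (y : T.V → ℝ) : Option T.V → ℝ
  | none => 3 * minCoord T i₀ y
  | some v => y v - if v ∈ Set.range (T.tri i₀) then minCoord T i₀ y else 0

variable {T i₀}

lemma minCoord_le (y : T.V → ℝ) (k : Fin 3) : minCoord T i₀ y ≤ y (T.tri i₀ k) := by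
  fin_cases k <;> simp [minCoord]

lemma exists_minCoord_eq (y : T.V → ℝ) : ∃ k, minCoord T i₀ y = y (T.tri i₀ k) := by
  unfold minCoord
  rcases min_choice (y (T.tri i₀ 0)) (min (y (T.tri i₀ 1)) (y (T.tri i₀ 2))) with h | h
  · exact ⟨0, h⟩
  · rcases min_choice (y (T.tri i₀ 1)) (y (T.tri i₀ 2)) with h' | h'
    · exact ⟨1, h.trans h'⟩
    · exact ⟨2, h.trans h'⟩

lemma minCoord_nonneg {y : T.V → ℝ} (hy : ∀ v, 0 ≤ y v) : 0 ≤ minCoord T i₀ y := by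
  obtain ⟨k, hk⟩ := exists_minCoord_eq (i₀ := i₀) y
  exact hk ▸ hy _

lemma minCoord_eq_zero {y : T.V → ℝ} (hy : ∀ v, 0 ≤ y v) {k : Fin 3} (hk : y (T.tri i₀ k) = 0) :
    minCoord T i₀ y = 0 :=
  le_antisymm (hk ▸ minCoord_le y k) (minCoord_nonneg hy)

lemma continuous_minCoord : Continuous (minCoord T i₀) := by
  unfold minCoord
  fun_prop

/-- Both vertex sets have three elements, so an inclusion would be an equality. Consequently
`minCoord` vanishes at points supported on a triangle other than `i₀`. -/
lemma exists_tri_notMem_range {j : T.ι} (hj : j ≠ i₀) :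
    ∃ k, T.tri i₀ k ∉ Set.range (T.tri j) := by
  by_contra! h
  refine hj (T.eq_of_range_eq _ _ ?_).symm
  refine Set.eq_of_subset_of_ncard_le (Set.range_subset_iff.2 h) ?_ (Set.finite_range _)
  rw [← Set.image_univ, ← Set.image_univ, Set.ncard_image_of_injective _ (T.tri_injective j),
    Set.ncard_image_of_injective _ (T.tri_injective i₀)]

lemma sum_ite_mem_range_tri (c : ℝ) [DecidablePred (· ∈ Set.range (T.tri i₀))] :
    ∑ v, (if v ∈ Set.range (T.tri i₀) then c else 0) = 3 * c := by
  classical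
  rw [← Finset.sum_filter, Finset.sum_const,
    show Finset.univ.filter (· ∈ Set.range (T.tri i₀)) = Finset.univ.image (T.tri i₀) by
      ext v; simp,
    Finset.card_image_of_injective _ (T.tri_injective i₀)]
  simp

lemma mergeCoords_mem {x : Option T.V → ℝ}
    (hx : x ∈ realization (T.centralSubdivision i₀).complex) :
    mergeCoords T i₀ x ∈ realization T.complex := by
  classical
  obtain ⟨h0, h1, i, hi⟩ := mem_realization_complex_iff.1 hx
  refine mem_realization_complex_iff.2 ⟨fun v => ?_, ?_, ?_⟩
  · unfold mergeCoords
    have := h0 none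
    have := h0 (some v)
    split_ifs <;> positivity
  · have h2 : x none + ∑ v, x (some v) = 1 := (Fintype.sum_option x).symm.trans h1
    simp only [mergeCoords]
    rw [Finset.sum_add_distrib, sum_ite_mem_range_tri]
    linarith
  · rcases i with j | k
    · have hn : x none = 0 := by
        by_contra h
        obtain ⟨l, hl⟩ := hi none h
        cases hl
      refine ⟨j, fun v hv => ?_⟩
      obtain ⟨l, hl⟩ := hi (some v) (by simpa [mergeCoords, hn] using hv)
      exact ⟨l, Option.some_injective _ hl⟩
    · refine ⟨i₀, fun v hv => ?_⟩
      by_contra hv'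
      obtain ⟨l, hl⟩ := hi (some v) (by
        rwa [mergeCoords, if_neg hv', add_zero] at hv)
      fin_cases l
      · exact hv' ⟨k, Option.some_injective _ hl⟩
      · exact hv' ⟨k + 1, Option.some_injective _ hl⟩
      · cases hl

lemma splitCoords_mem {y : T.V → ℝ} (hy : y ∈ realization T.complex) :
    splitCoords T i₀ y ∈ realization (T.centralSubdivision i₀).complex := by
  classical
  obtain ⟨h0, h1, j, hj⟩ := mem_realization_complex_iff.1 hy
  refine mem_realization_complex_iff.2 ⟨?_, ?_, ?_⟩
  · rintro (_ | v)
    · exact mul_nonneg (by norm_num) (minCoord_nonneg h0)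
    · simp only [splitCoords]
      split_ifs with h
      · obtain ⟨k, rfl⟩ := h
        exact sub_nonneg.2 (minCoord_le y k)
      · simpa using h0 v
  · refine (Fintype.sum_option (splitCoords T i₀ y)).trans ?_
    simp only [splitCoords]
    rw [Finset.sum_sub_distrib, sum_ite_mem_range_tri]
    linarith
  · by_cases hji : j = i₀
    · subst hji
      obtain ⟨k, hk⟩ := exists_minCoord_eq (i₀ := j) y
      -- Subtracting the minimum kills the coordinate at vertex `k`; what remains lies in the new
      -- triangle over the opposite edge, which starts at `k + 1`.
      refine ⟨Sum.inr (k + 1), ?_⟩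
      rintro (_ | v) hv
      · exact ⟨2, rfl⟩
      · have hvr : v ∈ Set.range (T.tri j) := by
          by_contra hv'
          simp only [splitCoords, if_neg hv', sub_zero] at hv
          exact hv' (hj v hv)
        obtain ⟨l, rfl⟩ := hvr
        have hlk : l ≠ k := by
          rintro rfl
          simp [splitCoords, hk] at hv
        have hl : l = k + 1 ∨ l = k + 1 + 1 := by
          clear hv hk
          revert l k
          decide
        rcases hl with rfl | rfl
        · exact ⟨0, rfl⟩
        · exact ⟨1, rfl⟩
    · obtain ⟨k, hk⟩ := exists_tri_notMem_range hji
      have hm : minCoord T i₀ y = 0 :=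
        minCoord_eq_zero h0 (k := k) (by by_contra h; exact hk (hj _ h))
      refine ⟨Sum.inl ⟨j, hji⟩, ?_⟩
      rintro (_ | v) hv
      · simp [splitCoords, hm] at hv
      · obtain ⟨l, rfl⟩ := hj v (by simpa [splitCoords, hm] using hv)
        exact ⟨l, rfl⟩

lemma mergeCoords_splitCoords (y : T.V → ℝ) : mergeCoords T i₀ (splitCoords T i₀ y) = y := by
  ext v
  simp only [mergeCoords, splitCoords]
  split_ifs <;> ring

/-- No triangle of the subdivision contains all three vertices of `i₀`. At a missing vertex the
merged coordinate is exactly the share `x none / 3`, and at the other two it is at least that. -/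
lemma minCoord_mergeCoords {x : Option T.V → ℝ}
    (hx : x ∈ realization (T.centralSubdivision i₀).complex) :
    minCoord T i₀ (mergeCoords T i₀ x) = x none / 3 := by
  obtain ⟨h0, -, i, hi⟩ := mem_realization_complex_iff.1 hx
  have hz : ∃ k, x (some (T.tri i₀ k)) = 0 := by
    rcases i with j | k
    · obtain ⟨k, hk⟩ := exists_tri_notMem_range j.2
      refine ⟨k, by_contra fun h => ?_⟩
      obtain ⟨l, hl⟩ := hi _ h
      exact hk ⟨l, Option.some_injective _ hl⟩
    · refine ⟨k + 2, by_contra fun h => ?_⟩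
      obtain ⟨l, hl⟩ := hi _ h
      fin_cases l
      · have := T.tri_injective i₀ (Option.some_injective _ hl)
        simp at this
      · have := T.tri_injective i₀ (Option.some_injective _ hl)
        simp at this
      · cases hl
  have hval : ∀ l, mergeCoords T i₀ x (T.tri i₀ l) = x (some (T.tri i₀ l)) + x none / 3 := by
    intro l
    simp [mergeCoords]
  obtain ⟨k, hk⟩ := hz
  obtain ⟨l, hl⟩ := exists_minCoord_eq (i₀ := i₀) (mergeCoords T i₀ x)
  apply le_antisymm
  · have := minCoord_le (i₀ := i₀) (mergeCoords T i₀ x) k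
    rwa [hval, hk, zero_add] at this
  · rw [hl, hval]
    exact le_add_of_nonneg_left (h0 _)

lemma splitCoords_mergeCoords {x : Option T.V → ℝ}
    (hx : x ∈ realization (T.centralSubdivision i₀).complex) :
    splitCoords T i₀ (mergeCoords T i₀ x) = x := by
  ext (_ | v)
  · simp only [splitCoords, minCoord_mergeCoords hx]
    ring
  · simp only [splitCoords, minCoord_mergeCoords hx, mergeCoords]
    ring

lemma continuous_mergeCoords : Continuous (mergeCoords T i₀) := by
  refine continuous_pi fun v => ?_
  simp only [mergeCoords]
  split_ifs <;> fun_prop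

lemma continuous_splitCoords : Continuous (splitCoords T i₀) := by
  refine continuous_pi ?_
  have := continuous_minCoord (i₀ := i₀)
  rintro (_ | v) <;> simp only [splitCoords]
  · fun_prop
  · split_ifs <;> fun_prop

variable (T i₀) in
/-- A complex and its central subdivision have homeomorphic realizations. -/
def centralSubdivisionHomeomorph :
    realization (T.centralSubdivision i₀).complex ≃ₜ realization T.complex where
  toFun x := ⟨mergeCoords T i₀ x.1, mergeCoords_mem x.2⟩
  invFun y := ⟨splitCoords T i₀ y.1, splitCoords_mem y.2⟩
  left_inv x := Subtype.ext (splitCoords_mergeCoords x.2)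
  right_inv y := Subtype.ext (mergeCoords_splitCoords _)
  continuous_toFun := by
    exact (continuous_mergeCoords.comp continuous_subtype_val).subtype_mk _
  continuous_invFun := by
    exact (continuous_splitCoords.comp continuous_subtype_val).subtype_mk _

end Realization

/-- The triangulation obtained from `T` by central subdivision of the triangle `i₀`. -/
def Triangulation.subdivide (T : Triangulation) (i₀ : T.ι) : Triangulation where
  toOrientedTriangles := T.toOrientedTriangles.centralSubdivision i₀
  homeomorphic_disk :=
    T.homeomorphic_disk.map ((centralSubdivisionHomeomorph T.toOrientedTriangles i₀).trans ·)
  coherent := centralSubdivision_coherent T.coherent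
  corner k := some (T.corner k)
  corner_injective := (Option.some_injective _).comp T.corner_injective
  boundary_iff := by
    rintro (_ | u) (_ | v)
    · simp [exists_hasDirectedEdge_centralSubdivision_none_left]
    · rw [exists_hasDirectedEdge_centralSubdivision_none_left,
        exists_hasDirectedEdge_centralSubdivision_none_right]
      simp
    · rw [exists_hasDirectedEdge_centralSubdivision_none_left,
        exists_hasDirectedEdge_centralSubdivision_none_right]
      simp
    · rw [exists_hasDirectedEdge_centralSubdivision_some_some,
        exists_hasDirectedEdge_centralSubdivision_some_some, T.boundary_iff]
      exact ⟨fun ⟨k, hu, hv⟩ => ⟨k, congrArg some hu, congrArg some hv⟩,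
        fun ⟨k, hu, hv⟩ => ⟨k, Option.some_injective _ hu, Option.some_injective _ hv⟩⟩

/-! ### The area polynomial of a central subdivision -/

section Substitution

variable {ι : Type*} (i₀ : ι) (R : Type*) [CommRing R]

open Classical in
/-- The substitution of the sum of three new variables for the variable `X i₀`. -/
def splitVar : MvPolynomial ι R →ₐ[R] MvPolynomial ({j // j ≠ i₀} ⊕ Fin 3) R :=
  aeval fun j => if h : j = i₀ then ∑ k, X (Sum.inr k) else X (Sum.inl ⟨j, h⟩)

lemma splitVar_X_self : splitVar i₀ R (X i₀) = ∑ k, X (Sum.inr k) := by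
  simp [splitVar]

variable {i₀} in
lemma splitVar_X_of_ne {j : ι} (hj : j ≠ i₀) :
    splitVar i₀ R (X j) = X (Sum.inl ⟨j, hj⟩) := by
  simp [splitVar, hj]

lemma map_splitVar {S : Type*} [CommRing S] (f : R →+* S) (p : MvPolynomial ι R) :
    map f (splitVar i₀ R p) = splitVar i₀ S (map f p) := by
  suffices h : (map f).comp (splitVar i₀ R).toRingHom =
      (splitVar i₀ S).toRingHom.comp (map f) from RingHom.congr_fun h p
  refine MvPolynomial.ringHom_ext (fun r => ?_) (fun j => ?_)
  · simp [MvPolynomial.algHom_C]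
  · by_cases hj : j = i₀
    · subst hj
      simp [splitVar_X_self]
    · simp [splitVar_X_of_ne _ hj]

lemma isHomogeneous_splitVar {d : ℕ} {p : MvPolynomial ι R} (hp : p.IsHomogeneous d) :
    (splitVar i₀ R p).IsHomogeneous d := by
  classical
  have := hp.aeval (n := 1)
    (fun j => if h : j = i₀ then ∑ k, X (Sum.inr k) else
      (X (Sum.inl ⟨j, h⟩) : MvPolynomial ({j // j ≠ i₀} ⊕ Fin 3) R)) (fun j => by
      split_ifs
      · exact IsHomogeneous.sum _ _ _ fun k _ => isHomogeneous_X _ _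
      · exact isHomogeneous_X _ _)
  rw [one_mul] at this
  exact this

/-- `splitVar` has a left inverse: send one new variable to `X i₀` and the other two to `0`. This
carries primitivity of the coefficients over to the subdivision. -/
lemma C_dvd_of_C_dvd_splitVar {c : R} {p : MvPolynomial ι R} (h : C c ∣ splitVar i₀ R p) :
    C c ∣ p := by
  let g : MvPolynomial ({j // j ≠ i₀} ⊕ Fin 3) R →ₐ[R] MvPolynomial ι R :=
    aeval (Sum.elim (fun j => X j.1) ![X i₀, 0, 0])
  have hg : g.comp (splitVar i₀ R) = AlgHom.id R _ := by
    ext1 j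
    by_cases hj : j = i₀
    · subst hj
      simp [g, splitVar_X_self, Fin.sum_univ_three]
    · simp [g, splitVar_X_of_ne _ hj]
  have := map_dvd g h
  rwa [← AlgHom.comp_apply, hg, AlgHom.id_apply, MvPolynomial.algHom_C] at this

/-- The third of the new variables is replaced by its expression in the other two and the variable
`X i₀`, which is made a coefficient. -/
def elimVar : MvPolynomial ({j // j ≠ i₀} ⊕ Fin 3) R →ₐ[R]
    MvPolynomial (Fin 2) (MvPolynomial ι R) :=
  aeval (Sum.elim (fun j => C (X j.1)) ![X 0, X 1, C (X i₀) - X 0 - X 1])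

variable {i₀ R} in
/-- A polynomial in the new variables is divisible by `splitVar i₀ R p` if all coefficients of
`elimVar i₀ R f` are divisible by `p`. -/
lemma splitVar_dvd {p : MvPolynomial ι R} {f : MvPolynomial ({j // j ≠ i₀} ⊕ Fin 3) R}
    (h : ∀ m, p ∣ (elimVar i₀ R f).coeff m) : splitVar i₀ R p ∣ f := by
  -- `θ` undoes `elimVar` and sends the constant `C p` to `splitVar i₀ R p`.
  let θ : MvPolynomial (Fin 2) (MvPolynomial ι R) →+*
      MvPolynomial ({j // j ≠ i₀} ⊕ Fin 3) R :=
    eval₂Hom (splitVar i₀ R).toRingHom ![X (Sum.inr 0), X (Sum.inr 1)]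
  have hθ : θ.comp (elimVar i₀ R).toRingHom = RingHom.id _ := by
    refine MvPolynomial.ringHom_ext (fun r => ?_) ?_
    · simp [θ, elimVar, MvPolynomial.algHom_C, IsScalarTower.algebraMap_apply R (MvPolynomial ι R)
        (MvPolynomial (Fin 2) (MvPolynomial ι R)), MvPolynomial.algebraMap_eq]
    · rintro (j | k)
      · simp [θ, elimVar, splitVar_X_of_ne _ j.2]
      · fin_cases k
        · simp [θ, elimVar]
        · simp [θ, elimVar]
        · simp only [Fin.reduceFinMk]
          simp [θ, elimVar, splitVar_X_self, Fin.sum_univ_three]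
          ring
  have h1 := map_dvd θ ((C_dvd_iff_dvd_coeff p (elimVar i₀ R f)).2 h)
  have h2 : θ (elimVar i₀ R f) = f := RingHom.congr_fun hθ f
  rw [h2] at h1
  simpa [θ] using h1

end Substitution

/-! ### Areas of drawings and the ideal of their relations -/

section Areas

lemma area_eq (a b c : Fin 2 → ℂ) :
    area a b c = 1 / 2 * ((b 0 - a 0) * (c 1 - a 1) - (c 0 - a 0) * (b 1 - a 1)) := by
  simp [area, Matrix.det_fin_three]
  ring

lemma sum_area_eq (t : Fin 3 → Fin 2 → ℂ) (d : Fin 2 → ℂ) :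
    ∑ k, area (t k) (t (k + 1)) d = area (t 0) (t 1) (t 2) := by
  simp only [Fin.sum_univ_three, area_eq, zero_add, Fin.reduceAdd]
  ring

/-- In a nondegenerate triangle there is a point that cuts off two triangles with prescribed
areas. -/
lemma exists_area_eq {t : Fin 3 → Fin 2 → ℂ} (ht : area (t 0) (t 1) (t 2) ≠ 0) (a b : ℂ) :
    ∃ d, area (t 0) (t 1) d = a ∧ area (t 1) (t 2) d = b := by
  set S := area (t 0) (t 1) (t 2) with hS
  -- Barycentric coordinates: each vertex is weighted by the area of the small triangle opposite to
  -- it.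
  refine ⟨fun i => (b * t 0 i + (S - a - b) * t 1 i + a * t 2 i) / S, ?_, ?_⟩
  · rw [area_eq] at hS ⊢
    field_simp
    rw [hS]
    ring
  · rw [area_eq] at hS ⊢
    field_simp
    rw [hS]
    ring

/-- The areas in a drawing of a central subdivision. -/
def subdividedAreas (T : Triangulation) (i₀ : T.ι) (ρ : Option T.V → Fin 2 → ℂ) :
    {j // j ≠ i₀} ⊕ Fin 3 → ℂ :=
  areaTuple (T.subdivide i₀) ρ

lemma subdividedAreas_inl (T : Triangulation) (i₀ : T.ι) (ρ : Option T.V → Fin 2 → ℂ)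
    (j : {j // j ≠ i₀}) :
    subdividedAreas T i₀ ρ (Sum.inl j) = areaTuple T (ρ ∘ some) j :=
  rfl

lemma subdividedAreas_inr (T : Triangulation) (i₀ : T.ι) (ρ : Option T.V → Fin 2 → ℂ)
    (k : Fin 3) :
    subdividedAreas T i₀ ρ (Sum.inr k) =
      area (ρ (some (T.tri i₀ k))) (ρ (some (T.tri i₀ (k + 1)))) (ρ none) :=
  rfl

lemma aeval_subdividedAreas_splitVar (T : Triangulation) (i₀ : T.ι) (ρ : Option T.V → Fin 2 → ℂ)
    (p : MvPolynomial T.ι ℂ) :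
    aeval (subdividedAreas T i₀ ρ) (splitVar i₀ ℂ p) = aeval (areaTuple T (ρ ∘ some)) p := by
  suffices h : (aeval (subdividedAreas T i₀ ρ)).comp (splitVar i₀ ℂ) =
      aeval (areaTuple T (ρ ∘ some)) from DFunLike.congr_fun h p
  ext1 j
  by_cases hj : j = i₀
  · subst hj
    simp only [AlgHom.comp_apply, splitVar_X_self, map_sum, aeval_X]
    exact sum_area_eq (fun k => ρ (some (T.tri j k))) (ρ none)
  · simp [splitVar_X_of_ne _ hj, subdividedAreas_inl]

/-- Some drawing has nonzero area at the triangle `i₀`. -/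
lemma exists_areaTuple_ne_zero (T : Triangulation) (i₀ : T.ι) :
    ∃ ρ ∈ drawings T, areaTuple T ρ i₀ ≠ 0 := by
  classical
  -- A corner off the triangle can be moved to satisfy the parallelogram relation without changing
  -- the area at `i₀`.
  obtain ⟨k, hk⟩ : ∃ k, T.corner k ∉ Set.range (T.tri i₀) := by
    by_contra! h
    choose f hf using h
    have hinj : Function.Injective f := fun a b hab =>
      T.corner_injective (by rw [← hf a, ← hf b, hab])
    simpa using Fintype.card_le_of_injective f hinj
  let σ : T.V → Fin 2 → ℂ := Function.extend (T.tri i₀) ![0, ![1, 0], ![0, 1]] 0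
  have hσ : ∀ l, σ (T.tri i₀ l) = ![0, ![1, 0], ![0, 1]] l :=
    fun l => (T.tri_injective i₀).extend_apply _ _ _
  have harea : ∀ w, areaTuple T (Function.update σ (T.corner k) w) i₀ ≠ 0 := by
    intro w
    have hne : ∀ l, T.tri i₀ l ≠ T.corner k := fun l h => hk ⟨l, h⟩
    simp [areaTuple, Function.update_of_ne (hne _), hσ, area_eq]
  suffices h : ∃ w, Function.update σ (T.corner k) w ∈ drawings T from
    h.elim fun w hw => ⟨_, hw, harea w⟩
  have hc : ∀ l, l ≠ k → ∀ w, Function.update σ (T.corner k) w (T.corner l) = σ (T.corner l) :=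
    fun l hl w => Function.update_of_ne (T.corner_injective.ne hl) _ _
  simp only [drawings, Set.mem_ofPred_eq]
  clear harea hσ hk
  fin_cases k
  · refine ⟨σ (T.corner 1) + σ (T.corner 3) - σ (T.corner 2), ?_⟩
    rw [hc 1 (by decide), hc 2 (by decide), hc 3 (by decide)]
    simp
  · refine ⟨σ (T.corner 0) + σ (T.corner 2) - σ (T.corner 3), ?_⟩
    rw [hc 0 (by decide), hc 2 (by decide), hc 3 (by decide)]
    simp
  · refine ⟨σ (T.corner 1) + σ (T.corner 3) - σ (T.corner 0), ?_⟩
    rw [hc 1 (by decide), hc 0 (by decide), hc 3 (by decide)]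
    simp
  · refine ⟨σ (T.corner 0) + σ (T.corner 2) - σ (T.corner 1), ?_⟩
    rw [hc 1 (by decide), hc 2 (by decide), hc 0 (by decide)]
    simp

/-- Along a line of drawings the areas are polynomial functions. -/
lemma exists_polynomial_areaTuple (T : Triangulation) (ρ ρ' : T.V → Fin 2 → ℂ) :
    ∃ P : T.ι → Polynomial ℂ, ∀ t i,
      (P i).eval t = areaTuple T (fun v => ρ v + t • (ρ' v - ρ v)) i := by
  let x (v : T.V) (l : Fin 2) : Polynomial ℂ :=
    Polynomial.C (ρ v l) + Polynomial.X * Polynomial.C (ρ' v l - ρ v l)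
  refine ⟨fun i => Polynomial.C (1 / 2) *
    ((x (T.tri i 1) 0 - x (T.tri i 0) 0) * (x (T.tri i 2) 1 - x (T.tri i 0) 1) -
      (x (T.tri i 2) 0 - x (T.tri i 0) 0) * (x (T.tri i 1) 1 - x (T.tri i 0) 1)), fun t i => ?_⟩
  simp only [areaTuple, area_eq, x, Polynomial.eval_mul, Polynomial.eval_sub, Polynomial.eval_add,
    Polynomial.eval_C, Polynomial.eval_X, Pi.add_apply, Pi.smul_apply, Pi.sub_apply, smul_eq_mul]

/-- A polynomial that vanishes on the area tuples of the drawings in which the triangle `i₀` is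
nondegenerate vanishes on all area tuples. -/
lemma mem_vanishingIdeal_of_nondegenerate {T : Triangulation} (i₀ : T.ι) {f : MvPolynomial T.ι ℂ}
    (hf : ∀ ρ ∈ drawings T, areaTuple T ρ i₀ ≠ 0 → aeval (areaTuple T ρ) f = 0) :
    f ∈ vanishingIdeal ℂ (areaTuple T '' drawings T) := by
  rw [mem_vanishingIdeal_iff]
  rintro _ ⟨ρ, hρ, rfl⟩
  obtain ⟨ρ', hρ', hne⟩ := exists_areaTuple_ne_zero T i₀
  obtain ⟨P, hP⟩ := exists_polynomial_areaTuple T ρ ρ'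
  have hline : ∀ t : ℂ, (fun v => ρ v + t • (ρ' v - ρ v)) ∈ drawings T := by
    intro t
    simp only [drawings, Set.mem_ofPred_eq] at hρ hρ' ⊢
    ext l
    have h1 := congrFun hρ l
    have h2 := congrFun hρ' l
    simp only [Pi.add_apply, Pi.smul_apply, Pi.sub_apply, smul_eq_mul] at h1 h2 ⊢
    linear_combination (1 - t) * h1 + t * h2
  have heval : ∀ t, (aeval P f).eval t =
      aeval (areaTuple T (fun v => ρ v + t • (ρ' v - ρ v))) f := by
    intro t
    have h := map_aeval P (Polynomial.evalRingHom t) f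
    rw [Polynomial.coe_evalRingHom] at h
    rw [h, aeval_def, eval₂_eq_eval_map, ← eval₂_eq_eval_map]
    simp only [coe_eval₂Hom]
    congr 1
    · ext
      simp
    · exact funext (hP t)
  -- On the line from `ρ` to `ρ'` one of the two factors vanishes at each `t`. Since `P i₀` is
  -- nonzero at `t = 1`, the other factor is the zero polynomial, in particular at `t = 0`.
  have hmul : aeval P f * P i₀ = 0 := by
    refine Polynomial.funext fun t => ?_
    rw [Polynomial.eval_mul, Polynomial.eval_zero, heval, hP]
    by_cases h : areaTuple T (fun v => ρ v + t • (ρ' v - ρ v)) i₀ = 0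
    · rw [h, mul_zero]
    · rw [hf _ (hline t) h, zero_mul]
  have hPne : P i₀ ≠ 0 := by
    intro h
    have := hP 1 i₀
    simp [h] at this
    exact hne this.symm
  have h0 := heval 0
  rw [(mul_eq_zero.1 hmul).resolve_right hPne] at h0
  simpa using h0.symm

/-- With `ρ` fixed, moving the new vertex realizes every pair of values of the first two new areas.
So `elimVar i₀ ℂ f`, with its coefficients evaluated at `ρ`, vanishes on all of ℂ² and is zero. -/
lemma aeval_coeff_elimVar {T : Triangulation} {i₀ : T.ι}
    {f : MvPolynomial ({j // j ≠ i₀} ⊕ Fin 3) ℂ}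
    (hf : ∀ ρ ∈ drawings (T.subdivide i₀), aeval (subdividedAreas T i₀ ρ) f = 0)
    {ρ : T.V → Fin 2 → ℂ} (hρ : ρ ∈ drawings T) (hne : areaTuple T ρ i₀ ≠ 0) (m : Fin 2 →₀ ℕ) :
    aeval (areaTuple T ρ) ((elimVar i₀ ℂ f).coeff m) = 0 := by
  let g := (aeval (areaTuple T ρ) : MvPolynomial T.ι ℂ →ₐ[ℂ] ℂ)
  suffices h : map g.toRingHom (elimVar i₀ ℂ f) = 0 by
    have := congrArg (coeff m) h
    rwa [coeff_map, coeff_zero] at this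
  refine MvPolynomial.funext fun x => ?_
  obtain ⟨d, hd0, hd1⟩ := exists_area_eq (t := fun k => ρ (T.tri i₀ k)) hne (x 0) (x 1)
  let ρ' : Option T.V → Fin 2 → ℂ := fun v => v.elim d ρ
  have hsum := sum_area_eq (fun k => ρ (T.tri i₀ k)) d
  rw [map_zero, ← hf ρ' hρ]
  suffices h : ((eval x).comp (map g.toRingHom)).comp (elimVar i₀ ℂ).toRingHom =
      (aeval (subdividedAreas T i₀ ρ')).toRingHom from RingHom.congr_fun h f
  refine MvPolynomial.ringHom_ext (fun r => ?_) ?_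
  · simp [g, MvPolynomial.algHom_C, IsScalarTower.algebraMap_apply ℂ (MvPolynomial T.ι ℂ)
        (MvPolynomial (Fin 2) (MvPolynomial T.ι ℂ)), MvPolynomial.algebraMap_eq]
  · rintro (j | k)
    · simp [g, elimVar, subdividedAreas_inl]
      rfl
    · have h2 : areaTuple T ρ i₀ - x 0 - x 1 =
          area (ρ (T.tri i₀ 2)) (ρ (T.tri i₀ 0)) d := by
        rw [Fin.sum_univ_three] at hsum
        simp only [areaTuple]
        rw [← hd0, ← hd1, ← hsum]
        simp only [zero_add, Fin.reduceAdd]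
        ring
      fin_cases k
      · simpa [g, elimVar, subdividedAreas_inr, ρ'] using hd0.symm
      · simpa [g, elimVar, subdividedAreas_inr, ρ'] using hd1.symm
      · simpa [g, elimVar, subdividedAreas_inr, ρ'] using h2

/-- The area polynomial of a central subdivision. -/
theorem IsAreaPolynomial.subdivide {T : Triangulation} {p : MvPolynomial T.ι ℤ}
    (hp : IsAreaPolynomial T p) (i₀ : T.ι) :
    IsAreaPolynomial (T.subdivide i₀) (splitVar i₀ ℤ p) := by
  obtain ⟨⟨d, hd⟩, hprim, hideal⟩ := hp
  refine ⟨⟨d, isHomogeneous_splitVar i₀ ℤ hd⟩,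
    fun c hc => hprim c (C_dvd_of_C_dvd_splitVar i₀ ℤ hc), ?_⟩
  have hmap : map (Int.castRingHom ℂ) (splitVar i₀ ℤ p) =
      splitVar i₀ ℂ (map (Int.castRingHom ℂ) p) := map_splitVar i₀ ℤ _ p
  refine le_antisymm (fun f hf => ?_) ?_
  · refine Ideal.mem_span_singleton.2 (hmap ▸ splitVar_dvd fun m => ?_)
    rw [← Ideal.mem_span_singleton, ← hideal]
    refine mem_vanishingIdeal_of_nondegenerate i₀ fun ρ hρ hne =>
      aeval_coeff_elimVar (fun ρ' hρ' => ?_) hρ hne m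
    exact mem_vanishingIdeal_iff.1 hf _ ⟨ρ', hρ', rfl⟩
  · rw [Ideal.span_singleton_le_iff_mem, mem_vanishingIdeal_iff]
    rintro _ ⟨ρ, hρ, rfl⟩
    refine (congrArg _ hmap).trans ((aeval_subdividedAreas_splitVar T i₀ ρ _).trans ?_)
    have : map (Int.castRingHom ℂ) p ∈ vanishingIdeal ℂ (areaTuple T '' drawings T) :=
      hideal ▸ Ideal.mem_span_singleton_self _
    refine mem_vanishingIdeal_iff.1 this _ ⟨ρ ∘ some, ?_, rfl⟩
    exact hρ

end Areas

/-! ### Area factors and algebraic subdivision -/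

section Encyclopedia

variable {K : Type*} [Field K]

/-- Merges specialization and renumbering into one substitution; the default `0` of
`Function.extend` is the value at the discarded variables. -/
lemma rename_specialize {σ : Type*} {l : ℕ} (L : Finset σ) (e : L ≃ Fin l)
    (p : MvPolynomial σ K) :
    rename e (specialize L p) =
      aeval (Function.extend (fun j => (e.symm j : σ)) X 0 : σ → MvPolynomial (Fin l) K) p := by
  classical
  suffices h : (rename e).comp (aeval (fun i => if h : i ∈ L then X ⟨i, h⟩ else 0)) =
      aeval (Function.extend (fun j => (e.symm j : σ)) X 0 : σ → MvPolynomial (Fin l) K) from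
    DFunLike.congr_fun h p
  have hinj : Function.Injective fun j => (e.symm j : σ) :=
    Subtype.val_injective.comp e.symm.injective
  ext1 i
  simp only [AlgHom.comp_apply, aeval_X]
  by_cases hi : i ∈ L
  · have := hinj.extend_apply (X : Fin l → MvPolynomial (Fin l) K) 0 (e ⟨i, hi⟩)
    simp only [Equiv.symm_apply_apply] at this
    simp [hi, this]
  · rw [Function.extend_apply', dif_neg hi]
    · simp
    · rintro ⟨j, rfl⟩
      exact hi (e.symm j).2

/-- The specialization to a set of `l` variables, described by an injective numbering `f`. -/
lemma isAreaFactor_iff {l : ℕ} {q : MvPolynomial (Fin l) K} :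
    IsAreaFactor q ↔ Irreducible q ∧ ∃ (T : Triangulation) (p : MvPolynomial T.ι ℤ)
      (f : Fin l → T.ι), Function.Injective f ∧ IsAreaPolynomial T p ∧
        q ∣ aeval (Function.extend f X 0 : T.ι → MvPolynomial (Fin l) K)
          (map (Int.castRingHom K) p) := by
  classical
  constructor
  · rintro ⟨T, p, L, e, hp, hq, hdvd⟩
    rw [rename_specialize] at hdvd
    exact ⟨hq, T, p, _, Subtype.val_injective.comp e.symm.injective, hp, hdvd⟩
  · rintro ⟨hq, T, p, f, hf, hp, hdvd⟩
    let e : Fin l ≃ (Finset.univ.image f : Finset T.ι) :=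
      Equiv.ofBijective (fun j => ⟨f j, Finset.mem_image_of_mem f (Finset.mem_univ j)⟩)
        ⟨fun a b h => hf (congrArg Subtype.val h), fun ⟨i, hi⟩ => by
          obtain ⟨j, -, rfl⟩ := Finset.mem_image.1 hi
          exact ⟨j, rfl⟩⟩
    refine ⟨T, p, _, e.symm, hp, hq, ?_⟩
    rw [rename_specialize]
    exact hdvd

/-- The scalar is a unit and the permutation is absorbed into the numbering of `L`. -/
lemma IsAreaFactor.of_polyEquiv {l : ℕ} {q q' : MvPolynomial (Fin l) K} (hq : IsAreaFactor q)
    (h : PolyEquiv q q') : IsAreaFactor q' := by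
  obtain ⟨T, p, L, e, hp, hirr, hdvd⟩ := hq
  obtain ⟨c, hc, π, rfl⟩ := h
  have hassoc : Associated (rename π q) (C c * rename π q) :=
    ⟨(hc.isUnit.map (C : K →+* MvPolynomial (Fin l) K)).unit, by simp [mul_comm]⟩
  refine ⟨T, p, L, e.trans π, hp, ?_, ?_⟩
  · rw [← hassoc.irreducible_iff]
    exact (MulEquiv.irreducible_iff (renameEquiv K π)).2 hirr
  · rw [← hassoc.dvd_iff_dvd_left]
    have := map_dvd (rename π) hdvd
    rw [rename_rename] at this
    exact this

lemma mem_encyclopedia_iff {l : ℕ} {q : MvPolynomial (Fin l) K} :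
    q ∈ encyclopedia K l ↔ 0 < l ∧ IsAreaFactor q := by
  refine and_congr_right fun _ => ⟨fun ⟨q', h, hq'⟩ => hq'.of_polyEquiv h, fun h => ⟨q, ?_, h⟩⟩
  exact ⟨1, one_ne_zero, 1, by simp⟩

/-! ### Irreducibility under algebraic subdivision -/

section Subst

variable {n : ℕ} (i : Fin n) (e : Option (Fin n) ≃ Fin (n + 1))

variable (K) in
/-- The substitution of a sum of two variables for the variable `X i`. -/
def algSubdivide : MvPolynomial (Fin n) K →ₐ[K] MvPolynomial (Fin (n + 1)) K :=
  aeval fun j => if j = i then X (e (some i)) + X (e none) else X (e (some j))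

variable (K) in
/-- The coordinate change that takes the variable `X i` to `X i + X none`. -/
def shear : MvPolynomial (Option (Fin n)) K ≃ₐ[K] MvPolynomial (Option (Fin n)) K :=
  AlgEquiv.ofAlgHom
    (aeval fun j => if j = some i then X (some i) + X none else X j)
    (aeval fun j => if j = some i then X (some i) - X none else X j)
    (by ext1 j; by_cases hj : j = some i <;> simp [hj])
    (by ext1 j; by_cases hj : j = some i <;> simp [hj])

/-- Apart from the inclusion as constant polynomials, all factors are isomorphisms, so primality of
the result is primality of a constant `Polynomial.C q`. -/
lemma algSubdivide_eq (q : MvPolynomial (Fin n) K) :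
    algSubdivide K i e q =
      renameEquiv K e (shear K i ((optionEquivLeft K (Fin n)).symm (Polynomial.C q))) := by
  have h1 : (optionEquivLeft K (Fin n)).symm (Polynomial.C q) = rename some q := by
    rw [AlgEquiv.symm_apply_eq, optionEquivLeft_apply, aeval_rename]
    suffices h : (Polynomial.CAlgHom (R := K) (A := MvPolynomial (Fin n) K)) = _ from
      DFunLike.congr_fun h q
    ext1 j
    simp
  rw [h1]
  suffices h : algSubdivide K i e = ((renameEquiv K e).toAlgHom.comp
      (shear K i).toAlgHom).comp (rename some) from DFunLike.congr_fun h q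
  ext1 j
  by_cases hj : j = i <;> simp [algSubdivide, shear, hj]

lemma irreducible_algSubdivide_iff {q : MvPolynomial (Fin n) K} :
    Irreducible (algSubdivide K i e q) ↔ Irreducible q := by
  rw [algSubdivide_eq, MulEquiv.irreducible_iff, MulEquiv.irreducible_iff,
    MulEquiv.irreducible_iff, UniqueFactorizationMonoid.irreducible_iff_prime,
    UniqueFactorizationMonoid.irreducible_iff_prime, Polynomial.prime_C_iff]

end Subst

lemma IsAreaFactor.algSubdivide {n : ℕ} {i : Fin n} {e : Option (Fin n) ≃ Fin (n + 1)}
    {q : MvPolynomial (Fin n) K} (hq : IsAreaFactor q) :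
    IsAreaFactor (algSubdivide K i e q) := by
  obtain ⟨hirr, T, p, f, hf, hp, hdvd⟩ := isAreaFactor_iff.1 hq
  refine isAreaFactor_iff.2 ⟨(irreducible_algSubdivide_iff i e).2 hirr, T.subdivide (f i),
    splitVar (f i) ℤ p, ?_⟩
  -- The new triangles `0` and `1` carry `X'` and `X''`; triangle `2` is left out of the numbering
  -- and so is specialized to `0`.
  let g : Option (Fin n) → {j // j ≠ f i} ⊕ Fin 3
    | none => Sum.inr 1
    | some j => if h : j = i then Sum.inr 0 else Sum.inl ⟨f j, hf.ne h⟩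
  have hgi : g (some i) = Sum.inr 0 := by simp [g]
  have hgj : ∀ j (h : j ≠ i), g (some j) = Sum.inl ⟨f j, hf.ne h⟩ := fun j h => by simp [g, h]
  have hg : Function.Injective g := by
    rintro (_ | a) (_ | b) hab
    · rfl
    · by_cases hb : b = i
      · subst hb
        simp [hgi, show g none = Sum.inr 1 from rfl] at hab
      · simp [hgj b hb, show g none = Sum.inr 1 from rfl] at hab
    · by_cases ha : a = i
      · subst ha
        simp [hgi, show g none = Sum.inr 1 from rfl] at hab
      · simp [hgj a ha, show g none = Sum.inr 1 from rfl] at hab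
    · by_cases ha : a = i <;> by_cases hb : b = i
      · rw [ha, hb]
      · subst ha
        simp [hgi, hgj b hb] at hab
      · subst hb
        simp [hgi, hgj a ha] at hab
      · rw [hgj a ha, hgj b hb] at hab
        simpa [hf.eq_iff] using hab
  have hg' : Function.Injective (g ∘ e.symm) := hg.comp e.symm.injective
  have hX : ∀ o, Function.extend (g ∘ e.symm) (X : _ → MvPolynomial (Fin (n + 1)) K) 0 (g o) =
      X (e o) := by
    intro o
    simpa using hg'.extend_apply (X : _ → MvPolynomial (Fin (n + 1)) K) 0 (e o)
  refine ⟨g ∘ e.symm, hg', hp.subdivide (f i), ?_⟩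
  have h := map_dvd (AreaEncyclopedia.algSubdivide K i e) hdvd
  have hmap : map (Int.castRingHom K) (splitVar (f i) ℤ p) =
      splitVar (f i) K (map (Int.castRingHom K) p) := map_splitVar (f i) ℤ _ p
  refine h.trans (dvd_of_eq ?_)
  refine Eq.trans ?_ (congrArg _ hmap).symm
  suffices h : (AreaEncyclopedia.algSubdivide K i e).comp (aeval (Function.extend f X 0)) =
      (aeval (Function.extend (g ∘ e.symm) X 0)).comp (splitVar (f i) K) from
    DFunLike.congr_fun h _
  ext1 t
  simp only [AlgHom.comp_apply, aeval_X]
  by_cases ht : t = f i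
  · subst ht
    have h2 : Function.extend (g ∘ e.symm) (X : _ → MvPolynomial (Fin (n + 1)) K) 0
        (Sum.inr 2) = 0 := by
      rw [Function.extend_apply']
      · rfl
      · rintro ⟨a, ha⟩
        rcases hea : e.symm a with _ | b
        · simp [hea, g] at ha
        · by_cases hb : b = i <;> simp [hea, g, hb] at ha
    have h0 := hX (some i)
    rw [hgi] at h0
    have h1 : Function.extend (g ∘ e.symm) (X : _ → MvPolynomial (Fin (n + 1)) K) 0
        (Sum.inr 1) = X (e none) := hX none
    rw [splitVar_X_self, hf.extend_apply, map_sum, Fin.sum_univ_three]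
    simp only [aeval_X, h0, h1, h2]
    simp [AreaEncyclopedia.algSubdivide]
  · rw [splitVar_X_of_ne _ ht, aeval_X]
    by_cases hj : ∃ j, f j = t
    · obtain ⟨j, rfl⟩ := hj
      have hji : j ≠ i := fun h => ht (h ▸ rfl)
      have hXj := hX (some j)
      rw [hgj j hji] at hXj
      refine Eq.trans ?_ hXj.symm
      rw [hf.extend_apply]
      simp [AreaEncyclopedia.algSubdivide, hji]
    · rw [Function.extend_apply' _ _ _ hj, Function.extend_apply']
      · simp
      · rintro ⟨a, ha⟩
        rcases hea : e.symm a with _ | b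
        · simp [hea, g] at ha
        · by_cases hb : b = i
          · simp [hea, g, hb] at ha
          · simp [hea, g, hb] at ha
            exact hj ⟨b, ha⟩

/-- Setting `X'' = 0` recovers `q` and turns the specialization of `p` into one with that variable
removed from the set. -/
lemma isAreaFactor_of_algSubdivide {n : ℕ} {i : Fin n} {e : Option (Fin n) ≃ Fin (n + 1)}
    {q : MvPolynomial (Fin n) K} (hq : IsAreaFactor (algSubdivide K i e q)) :
    IsAreaFactor q := by
  obtain ⟨hirr, T, p, f, hf, hp, hdvd⟩ := isAreaFactor_iff.1 hq
  have hf' : Function.Injective fun j => f (e (some j)) :=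
    hf.comp (e.injective.comp (Option.some_injective _))
  refine isAreaFactor_iff.2 ⟨(irreducible_algSubdivide_iff i e).1 hirr, T, p,
    fun j => f (e (some j)), hf', hp, ?_⟩
  let g : MvPolynomial (Fin (n + 1)) K →ₐ[K] MvPolynomial (Fin n) K :=
    aeval fun a => (e.symm a).elim 0 X
  have hgq : g (algSubdivide K i e q) = q := by
    suffices h : g.comp (algSubdivide K i e) = AlgHom.id K _ from DFunLike.congr_fun h q
    ext1 j
    by_cases hj : j = i <;> simp [g, algSubdivide, hj]
  have h := map_dvd g hdvd
  rw [hgq] at h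
  refine h.trans (dvd_of_eq ?_)
  suffices h : g.comp (aeval (Function.extend f X 0)) =
      aeval (Function.extend (fun j => f (e (some j))) X 0) from DFunLike.congr_fun h _
  ext1 t
  simp only [AlgHom.comp_apply, aeval_X]
  by_cases ht : ∃ a, f a = t
  · obtain ⟨a, rfl⟩ := ht
    obtain ⟨o, rfl⟩ := e.surjective a
    rw [hf.extend_apply]
    rcases o with _ | j
    · rw [Function.extend_apply']
      · simp [g]
      · rintro ⟨j, hj⟩
        simpa using e.injective (hf hj)
    · rw [hf'.extend_apply]
      simp [g]
  · rw [Function.extend_apply' _ _ _ ht, Function.extend_apply']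
    · simp
    · rintro ⟨j, hj⟩
      exact ht ⟨_, hj⟩

theorem mem_encyclopedia_iff_of_isAlgSubdivision {l : ℕ} {q : MvPolynomial (Fin l) K}
    {q' : MvPolynomial (Fin (l + 1)) K} (h : IsAlgSubdivision q q') :
    q' ∈ encyclopedia K (l + 1) ↔ q ∈ encyclopedia K l := by
  obtain ⟨i, e, rfl⟩ := h
  rw [mem_encyclopedia_iff, mem_encyclopedia_iff]
  exact ⟨fun h => ⟨i.pos, isAreaFactor_of_algSubdivide h.2⟩,
    fun h => ⟨l.succ_pos, h.2.algSubdivide⟩⟩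

/-- A polynomial equivalent to a subdivision of `r` is a subdivision of a polynomial equivalent
to `r`. -/
lemma IsAlgSubdivision.exists_of_polyEquiv {l : ℕ} {r : MvPolynomial (Fin l) K}
    {q q' : MvPolynomial (Fin (l + 1)) K} (h : IsAlgSubdivision r q') (hq : PolyEquiv q' q) :
    ∃ r', PolyEquiv r r' ∧ IsAlgSubdivision r' q := by
  obtain ⟨i, e, rfl⟩ := h
  obtain ⟨c, hc, π, rfl⟩ := hq
  -- The scalar moves into `r`, the permutation into the numbering `e`.
  refine ⟨C c * r, ⟨c, hc, 1, by simp⟩, i, e.trans π, ?_⟩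
  rw [map_mul, algHom_C, algebraMap_eq, rename_eq_aeval]
  congr 1
  rw [← AlgHom.comp_apply]
  refine DFunLike.congr_fun (MvPolynomial.algHom_ext fun j => ?_) r
  by_cases hj : j = i <;> simp [hj]

lemma SubdivisionStep.isAlgSubdivision {l : ℕ} {r : MvPolynomial (Fin l) K}
    {q : MvPolynomial (Fin (l + 1)) K} (h : SubdivisionStep ⟨l, r⟩ ⟨l + 1, q⟩) :
    IsAlgSubdivision r q := by
  cases h
  assumption

lemma exists_abridged_reflTransGen (l : ℕ) (q : MvPolynomial (Fin l) K)
    (hq : q ∈ encyclopedia K l) :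
    ∃ (m : ℕ) (q₀ : MvPolynomial (Fin m) K), q₀ ∈ abridged K m ∧
      Relation.ReflTransGen SubdivisionStep ⟨m, q₀⟩ ⟨l, q⟩ := by
  induction l with
  | zero => exact absurd hq.1 (lt_irrefl 0)
  | succ l ih =>
    by_cases hab : q ∈ abridged K (l + 1)
    · exact ⟨_, q, hab, Relation.ReflTransGen.refl⟩
    · simp only [abridged, Set.mem_ofPred_eq, hq, true_and, not_not] at hab
      obtain ⟨r, hr, q', hequiv, hstep⟩ := hab
      obtain ⟨r', -, hsub'⟩ := hstep.isAlgSubdivision.exists_of_polyEquiv hequiv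
      -- `q` itself is a subdivision of `r'`, so part 1 puts `r'` in the previous volume and the
      -- descent continues; it stops because volume `0` is empty.
      obtain ⟨m, q₀, hq₀, hgen⟩ := ih r' ((mem_encyclopedia_iff_of_isAlgSubdivision hsub').1 hq)
      exact ⟨m, q₀, hq₀, hgen.tail (SubdivisionStep.mk r' q hsub')⟩

lemma mem_encyclopedia_of_reflTransGen {a b : Σ n : ℕ, MvPolynomial (Fin n) K}
    (h : Relation.ReflTransGen SubdivisionStep a b) (ha : a.2 ∈ encyclopedia K a.1) :
    b.2 ∈ encyclopedia K b.1 := by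
  induction h with
  | refl => exact ha
  | tail _ hstep ih =>
    obtain ⟨q, q', h⟩ := hstep
    exact (mem_encyclopedia_iff_of_isAlgSubdivision h).2 ih

end Encyclopedia

end AreaEncyclopedia

end

theorem mainTheorem10 (K : Type*) [Field K] [CharZero K] :
    (∀ (l : ℕ) (q : MvPolynomial (Fin l) K) (q' : MvPolynomial (Fin (l + 1)) K),
      AreaEncyclopedia.IsAlgSubdivision q q' →
        (q' ∈ AreaEncyclopedia.encyclopedia K (l + 1) ↔ q ∈ AreaEncyclopedia.encyclopedia K l)) ∧
    (∀ (l : ℕ) (q : MvPolynomial (Fin l) K),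
      q ∈ AreaEncyclopedia.encyclopedia K l ↔
        ∃ (m : ℕ) (q₀ : MvPolynomial (Fin m) K), q₀ ∈ AreaEncyclopedia.abridged K m ∧
          Relation.ReflTransGen AreaEncyclopedia.SubdivisionStep ⟨m, q₀⟩ ⟨l, q⟩) :=
  ⟨fun _ _ _ h => AreaEncyclopedia.mem_encyclopedia_iff_of_isAlgSubdivision h,
    fun l q => ⟨AreaEncyclopedia.exists_abridged_reflTransGen l q,
      fun ⟨_, _, hq₀, h⟩ => AreaEncyclopedia.mem_encyclopedia_of_reflTransGen h hq₀.1⟩⟩
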